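/- Notation. A sequence $(B_n)_{n\ge1}$ of random variables with values in a topological space satisfies the large deviation principle (LDP) with speed $v_n\to\infty$ and rate function $I$ (lower semicontinuous, values in $[0,\infty]$) if $\limsup_n \frac1{v_n}\log P(B_n\in C)\le-\inf_C I$ for all closed $C$ and $\liminf_n\frac1{v_n}\log P(B_n\in O)\ge-\inf_O I$ for all open $O$; $I$ is good if $\{I\le\eta\}$ is compact for all real $\eta\ge0$. A function $\Lambda:\mathbb R^h\to(-\infty,\infty]$ is essentially smooth if, with $D_\Lambda=\{\Lambda<\infty\}$, the interior $D_\Lambda^\circ$ is non-empty, $\Lambda$ is differentiable on $D_\Lambda^\circ$, and $\|\nabla\Lambda(\theta_n)\|\to\infty$ for every sequence $(\theta_n)\subset D_\Lambda^\circ$ that converges to a boundary point of $D_\Lambda$. (A) Let $X_n(p)$ ($n\ge1$, $p\in[0,1]$) be $\mathbb R^h$-valued random variables on a probability space such that, for each $p$, the variables $X_1(p),X_2(p),\ldots$ are independent, $P(X_n(p)\ne0)=p$ for all $n$, and, for $p>0$, the conditional law of $X_n(p)$ given $X_n(p)\neq0$ is a law $\nu$ that depends neither on $n$ nor on $p$.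 Let $G(\theta)=\int e^{\langle\theta,x\rangle}\,\nu(dx)\in(0,\infty]$, and assume that $G$ is finite in a neighbourhood of $0$. (Thus $\mathbb E[e^{\langle\theta,X_n(p)\rangle}]=1-p+pG(\theta)$.) Let $(p_n)_{n\ge1}\subset[0,1]$ with $p_n\to p\in(0,1)$ and, if $(p_n)_{n\ge1}$ is not a constant sequence, assume that $G$ is essentially smooth. Then $\left(\frac{X_1(p_n)+\cdots+X_n(p_n)}{n}\right)_{n\ge1}$ satisfies the LDP with speed $n$ and good rate function $$I_{\mathrm{LD}}(x)=\sup_{\theta\in\mathbb R^h}\{\langle\theta,x\rangle-\log(1+p(G(\theta)-1))\}.$$ (B) Let $X_1,X_2,\ldots$ be i.i.d. $\mathbb R^h$-valued random variables such that $\kappa_X(\theta)=\log\mathbb E[e^{\langle\theta,X_1\rangle}]\in(-\infty,\infty]$ is finite in a neighbourhood of $0$, and let $\kappa_X^*(x)=\sup_{\theta\in\mathbb R^h}\{\langle\theta,x\rangle-\kappa_X(\theta)\}$. Let $D\subseteq\mathbb R^h$ contain $\{x:\kappa_X^*(x)<\infty\}$, with $\frac{X_1+\cdots+X_n}{n}\in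 D$ almost surely for every $n\ge1$ (for instance $D=\mathbb R^h$), and let $U:D\to\mathbb R^k$ be continuous. Then $\left(U\left(\frac{X_1+\cdots+X_n}{n}\right)\right)_{n\ge1}$ satisfies the LDP with speed $n$ and good rate function $$I_{\mathrm{LD},U}(y)=\inf\{\kappa_X^*(x):x\in D,\ U(x)=y\}.$$ -/

import Mathlib

open MeasureTheory ProbabilityTheory Filter Topology
open scoped ENNReal

/-- A rate function on `E`: a lower semicontinuous function with values in `[0, ∞]`. -/
structure IsRateFunction {E : Type*} [TopologicalSpace E] (I : E → EReal) : Prop where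
  nonneg : ∀ x, 0 ≤ I x
  lsc : LowerSemicontinuous I

/-- A good rate function: all level sets `{I ≤ η}`, `0 ≤ η < ∞`, are compact. -/
structure IsGoodRateFunction {E : Type*} [TopologicalSpace E] (I : E → EReal) : Prop
    extends IsRateFunction I where
  compact_level : ∀ η : ℝ, 0 ≤ η → IsCompact {x | I x ≤ (η : EReal)}

/-- The sequence `B` satisfies the large deviation principle with speed `v` and rate function `I`.
Logarithms, quotients, limits and infima are taken in the extended reals, with `log 0 = -∞`. -/
structure SatisfiesLDP {Ω E : Type*} [MeasurableSpace Ω] [TopologicalSpace E]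
    (P : Measure Ω) (B : ℕ → Ω → E) (v : ℕ → ℝ) (I : E → EReal) : Prop where
  speed : Tendsto v atTop atTop
  rate : IsRateFunction I
  upper : ∀ C : Set E, IsClosed C →
    limsup (fun n => ENNReal.log (P {ω | B n ω ∈ C}) / (v n : EReal)) atTop ≤ -⨅ x ∈ C, I x
  lower : ∀ O : Set E, IsOpen O →
    -⨅ x ∈ O, I x ≤ liminf (fun n => ENNReal.log (P {ω | B n ω ∈ O}) / (v n : EReal)) atTop

section euclidean

variable {E : Type*} [NormedAddCommGroup E] [InnerProductSpace ℝ E]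

/-- The moment generating function `θ ↦ 𝔼[exp ⟨θ, Y⟩]` of a random vector, valued in `[0, ∞]`. -/
noncomputable def vecMgf {Ω : Type*} [MeasurableSpace Ω] (Y : Ω → E) (P : Measure Ω) (θ : E) :
    ℝ≥0∞ :=
  ∫⁻ ω, ENNReal.ofReal (Real.exp (inner ℝ θ (Y ω))) ∂P

/-- The cumulant generating function `θ ↦ log 𝔼[exp ⟨θ, Y⟩]`, valued in the extended reals. -/
noncomputable def vecCgf {Ω : Type*} [MeasurableSpace Ω] (Y : Ω → E) (P : Measure Ω) (θ : E) :
    EReal :=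
  ENNReal.log (vecMgf Y P θ)

/-- The Legendre transform `x ↦ sup_θ (⟨θ, x⟩ - Λ θ)`. -/
noncomputable def legendreTransform (Λ : E → EReal) (x : E) : EReal :=
  ⨆ θ : E, (((inner ℝ θ x : ℝ) : EReal) - Λ θ)

/-- Essential smoothness of `Λ : E → (-∞, ∞]`: with `D = {Λ < ∞}`, the interior of `D` is
non-empty, `Λ` is differentiable on it, and `Λ` is steep, that is, the norm of the gradient tends
to infinity along every sequence in the interior of `D` that converges to a boundary point. -/
structure IsEssentiallySmooth [CompleteSpace E] (Λ : E → EReal) : Prop where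
  ne_bot : ∀ θ, Λ θ ≠ ⊥
  nonempty_interior : (interior {θ | Λ θ < ⊤}).Nonempty
  differentiable : ∀ θ ∈ interior {θ | Λ θ < ⊤},
    DifferentiableAt ℝ (fun η => (Λ η).toReal) θ
  steep : ∀ u : ℕ → E, (∀ n, u n ∈ interior {θ | Λ θ < ⊤}) →
    ∀ θ₀ ∈ frontier {θ | Λ θ < ⊤}, Tendsto u atTop (𝓝 θ₀) →
      Tendsto (fun n => ‖gradient (fun η => (Λ η).toReal) (u n)‖) atTop atTop

/-- For a family `X n p` of random vectors (`n : ℕ`, `p ∈ [0, 1]`): for each fixed `p` they are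
independent, they differ from `0` with probability `p`, and the conditional law given that they
differ from `0` is `ν`, whatever `p > 0` and `n`.  In particular, for each `p`, they are i.i.d. with
moment generating function `1 - p + p G`, with `G` the moment generating function of `ν`. -/
structure IsZeroInflatedFamily [MeasurableSpace E] {Ω : Type*} [MeasurableSpace Ω]
    (P : Measure Ω) (ν : Measure E) (X : ℕ → ℝ → Ω → E) : Prop where
  measurable : ∀ p ∈ Set.Icc (0 : ℝ) 1, ∀ n, Measurable (X n p)
  indep : ∀ p ∈ Set.Icc (0 : ℝ) 1, iIndepFun (fun n => X n p) P
  prob_ne_zero : ∀ p ∈ Set.Icc (0 : ℝ) 1, ∀ n, P {ω | X n p ω ≠ 0} = ENNReal.ofReal p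
  cond_law : ∀ p ∈ Set.Ioc (0 : ℝ) 1, ∀ n,
    Measure.map (X n p) (ProbabilityTheory.cond P {ω | X n p ω ≠ 0}) = ν

/-- The function `log (1 + p (G - 1)) = log ((1 - p) + p G)` for `p ∈ [0, 1]`, `G` valued in
`[0, ∞]`. -/
noncomputable def zeroInflatedCgf (p : ℝ) (G : E → ℝ≥0∞) (θ : E) : EReal :=
  ENNReal.log (ENNReal.ofReal (1 - p) + ENNReal.ofReal p * G θ)

end euclidean

/-! Both statements reduce to Cramér's theorem in finite dimension (`exponentialBounds_convPow`),
which is proved for the convolution powers of a law `μ` whose moment generating function is finite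
near `0`.

Upper bound: the set where the rate exceeds `a` is a union of open half-spaces, each of probability
at most `exp (-n a)` by Chernoff. Finiteness near `0` gives finitely many half-spaces that cover
everything outside a bounded set; compactness handles the rest of a closed set.

Lower bound: if the rate at `x` is below `a`, a tilt of a truncation of `μ` has mean close to `x`
and entropic cost below `a` (`exists_truncTilt`). The law of large numbers for the tilted law,
followed by a change of measure, bounds the mass near `x` from below.

(B) is then the contraction principle: the rate is `⊤` off `D`, so continuity on `D` suffices. For
(A), the zero-inflated laws with parameters `p_n` and `p` dominate each other up to a factor `exp
(-ε)` for large `n`, because both `p` and `1 - p` are positive. Their `n`-fold convolutions then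
dominate each other up to `exp (-n ε)`, which an LDP with speed `n` does not see
(`ExponentialBounds.of_comparable`). -/

/-- The sequence of set functions `Q` decays exponentially with speed `n`, as prescribed by `I`: an
LDP stated without logarithms. -/
structure ExponentialBounds {E : Type*} [TopologicalSpace E] (Q : ℕ → Set E → ℝ≥0∞)
    (I : E → EReal) : Prop where
  upper : ∀ C : Set E, IsClosed C → ∀ a : ℝ, (a : EReal) < ⨅ x ∈ C, I x →
    ∀ᶠ n : ℕ in atTop, Q n C ≤ ENNReal.ofReal (Real.exp (-(n * a)))
  lower : ∀ O : Set E, IsOpen O → ∀ x ∈ O, ∀ a : ℝ, I x < (a : EReal) →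
    ∀ᶠ n : ℕ in atTop, ENNReal.ofReal (Real.exp (-(n * a))) ≤ Q n O

theorem log_div_natCast_le_iff {q : ℝ≥0∞} {n : ℕ} (hn : 0 < n) (a : ℝ) :
    ENNReal.log q / (((n : ℕ) : ℝ) : EReal) ≤ ((-a : ℝ) : EReal) ↔
      q ≤ ENNReal.ofReal (Real.exp (-(n * a))) := by
  have hn' : (0 : EReal) < (((n : ℕ) : ℝ) : EReal) := by
    exact_mod_cast (Nat.cast_pos.2 hn : (0 : ℝ) < n)
  rw [EReal.div_le_iff_le_mul hn' (EReal.coe_ne_top _), ← EReal.exp_coe,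
    ← ENNReal.log_le_log_iff, EReal.log_exp, ← EReal.coe_mul]
  simp

theorem le_log_div_natCast_iff {q : ℝ≥0∞} {n : ℕ} (hn : 0 < n) (a : ℝ) :
    ((-a : ℝ) : EReal) ≤ ENNReal.log q / (((n : ℕ) : ℝ) : EReal) ↔
      ENNReal.ofReal (Real.exp (-(n * a))) ≤ q := by
  have hn' : (0 : EReal) < (((n : ℕ) : ℝ) : EReal) := by
    exact_mod_cast (Nat.cast_pos.2 hn : (0 : ℝ) < n)
  rw [EReal.le_div_iff_mul_le hn' (EReal.coe_ne_top _), ← EReal.exp_coe,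
    ← ENNReal.log_le_log_iff, EReal.log_exp, ← EReal.coe_mul]
  simp [mul_comm]

theorem ExponentialBounds.satisfiesLDP {Ω E : Type*} [MeasurableSpace Ω] [TopologicalSpace E]
    {P : Measure Ω} {B : ℕ → Ω → E} {I : E → EReal} (hI : IsRateFunction I)
    (h : ExponentialBounds (fun n A => P {ω | B n ω ∈ A}) I) :
    SatisfiesLDP P B (fun n => (n : ℝ)) I where
  speed := tendsto_natCast_atTop_atTop
  rate := hI
  upper C hC := by
    refine EReal.le_of_forall_lt_iff_le.1 fun b hb => ?_
    refine limsup_le_of_le (by isBoundedDefault) ?_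
    have hb' : ((-b : ℝ) : EReal) < ⨅ x ∈ C, I x := by
      rw [EReal.coe_neg]; exact EReal.neg_lt_comm.1 hb
    filter_upwards [h.upper C hC (-b) hb', eventually_gt_atTop 0] with n hn hn0
    simpa using (log_div_natCast_le_iff hn0 (-b)).2 hn
  lower O hO := by
    refine EReal.ge_of_forall_gt_iff_ge.1 fun b hb => ?_
    have hb' : ⨅ x ∈ O, I x < ((-b : ℝ) : EReal) := by
      rw [EReal.coe_neg]; exact EReal.lt_neg_comm.1 hb
    obtain ⟨x, hx⟩ := iInf_lt_iff.1 hb'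
    obtain ⟨hxO, hx⟩ := iInf_lt_iff.1 hx
    refine le_liminf_of_le (by isBoundedDefault) ?_
    filter_upwards [h.lower O hO x hxO (-b) hx, eventually_gt_atTop 0] with n hn hn0
    simpa using (le_log_div_natCast_iff hn0 (-b)).2 hn

/-- Compact sets of a Hausdorff space are closed, so compact level sets already give lower
semicontinuity. -/
theorem isGoodRateFunction_of_isCompact_level {E : Type*} [TopologicalSpace E] [T2Space E]
    {I : E → EReal} (h0 : ∀ x, 0 ≤ I x) (hc : ∀ η : ℝ, IsCompact {x | I x ≤ (η : EReal)}) :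
    IsGoodRateFunction I where
  nonneg := h0
  lsc := by
    rw [lowerSemicontinuous_iff_isClosed_preimage]
    intro y
    induction y with
    | bot =>
      convert isClosed_empty
      ext x
      simpa using fun h : I x = ⊥ => absurd (h0 x) (by simp [h])
    | coe η => exact (hc η).isClosed
    | top => simp
  compact_level η _ := hc η

/-- The push-forward of a rate function under a map that is relevant on `D` only. -/
noncomputable def contractedRate {E F : Type*} (I : E → EReal) (D : Set E) (U : E → F) (y : F) :
    EReal :=
  ⨅ (x) (_ : x ∈ D ∧ U x = y), I x

/-! ### Contraction principle for a map continuous on `D` -/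

section contraction

variable {E F : Type*} [TopologicalSpace E] [TopologicalSpace F] {I : E → EReal} {D : Set E}
  {U : E → F}

theorem isGoodRateFunction_contractedRate [T2Space F] (hI : IsGoodRateFunction I) (hU : ContinuousOn U D)
    (hD : ∀ x, I x < ⊤ → x ∈ D) : IsGoodRateFunction (contractedRate I D U) := by
  have hcpt : ∀ η : ℝ, IsCompact {x | I x ≤ (η : EReal)} := by
    intro η
    rcases le_or_gt 0 η with h | h
    · exact hI.compact_level η h
    · convert isCompact_empty
      ext x
      simpa using (show (η : EReal) < 0 by exact_mod_cast h).trans_le (hI.nonneg x)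
  have hsub : ∀ η : ℝ, {x | I x ≤ (η : EReal)} ⊆ D := fun η x hx =>
    hD x (lt_of_le_of_lt hx (EReal.coe_lt_top η))
  refine isGoodRateFunction_of_isCompact_level
    (fun y => le_iInf fun x => le_iInf fun _ => hI.nonneg x) fun η => ?_
  -- The infimum over a fibre is attained once it is finite, so level sets map onto level sets.
  have himg : {y | contractedRate I D U y ≤ (η : EReal)} = U '' {x | I x ≤ (η : EReal)} := by
    ext y
    constructor
    · intro hy
      -- The slack `1` makes the fibre meet a compact level set, before the infimum is known to be
      -- attained.
      have hy' : contractedRate I D U y < ((η + 1 : ℝ) : EReal) :=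
        lt_of_le_of_lt hy (by exact_mod_cast lt_add_one η)
      let K := {x | I x ≤ ((η + 1 : ℝ) : EReal)} ∩ U ⁻¹' {y}
      have hK : IsCompact K := by
        obtain ⟨t, ht, hte⟩ := continuousOn_iff_isClosed.1 (hU.mono (hsub (η + 1))) {y}
          isClosed_singleton
        have : K = {x | I x ≤ ((η + 1 : ℝ) : EReal)} ∩ t := by
          rw [Set.inter_comm, ← hte, Set.inter_comm]
        rw [this]
        exact (hcpt _).inter_right ht
      obtain ⟨x, hx⟩ := iInf_lt_iff.1 hy'
      obtain ⟨⟨hxD, hxy⟩, hx⟩ := iInf_lt_iff.1 hx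
      have hxK : x ∈ K := ⟨hx.le, hxy⟩
      obtain ⟨z, hzK, hz⟩ := LowerSemicontinuousOn.exists_isMinOn (f := I)
        ⟨x, hxK⟩ hK (hI.lsc.lowerSemicontinuousOn K)
      refine ⟨z, show I z ≤ η from le_trans (le_iInf fun w => le_iInf fun hw => ?_) hy, hzK.2⟩
      by_cases hwη : I w ≤ ((η + 1 : ℝ) : EReal)
      · exact hz ⟨hwη, hw.2⟩
      · exact hzK.1.trans (not_le.1 hwη).le
    · rintro ⟨x, hx, rfl⟩
      exact (iInf₂_le (f := fun z (_ : z ∈ D ∧ U z = U x) => I z) x ⟨hsub η hx, rfl⟩).trans hx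
  rw [himg]
  exact (hcpt η).image_of_continuousOn (hU.mono (hsub η))

theorem ExponentialBounds.contraction {Ω : Type*} [MeasurableSpace Ω] {P : Measure Ω}
    {B : ℕ → Ω → E} (h : ExponentialBounds (fun n A => P {ω | B n ω ∈ A}) I)
    (hU : ContinuousOn U D) (hD : ∀ x, I x < ⊤ → x ∈ D)
    (hB : ∀ n, 1 ≤ n → ∀ᵐ ω ∂P, B n ω ∈ D) :
    ExponentialBounds (fun n A => P {ω | U (B n ω) ∈ A}) (contractedRate I D U) where
  upper C hC a ha := by
    obtain ⟨t, ht, hte⟩ := continuousOn_iff_isClosed.1 hU C hC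
    obtain ⟨b, hab, hb⟩ := EReal.lt_iff_exists_real_btwn.1 ha
    -- The closed set `t` may contain points outside `D`, but there the rate is `⊤`.
    have key : (a : EReal) < ⨅ x ∈ t, I x := by
      refine hab.trans_le (le_iInf₂ fun x hx => ?_)
      by_cases hxD : x ∈ D
      · have hxC : U x ∈ C := (hte.symm ▸ (⟨hx, hxD⟩ : x ∈ t ∩ D) : x ∈ U ⁻¹' C ∩ D).1
        exact hb.le.trans ((iInf₂_le (U x) hxC).trans (iInf₂_le x ⟨hxD, rfl⟩))
      · exact le_of_le_of_eq le_top (not_lt_top_iff.1 fun hlt => hxD (hD x hlt)).symm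
    filter_upwards [h.upper t ht a key, eventually_ge_atTop 1] with n hn hn1
    refine (measure_mono_ae ?_).trans hn
    filter_upwards [hB n hn1] with ω hω hωC
    exact (hte ▸ (⟨hωC, hω⟩ : B n ω ∈ U ⁻¹' C ∩ D) : B n ω ∈ t ∩ D).1
  lower O hO y hy a ha := by
    obtain ⟨t, ht, hte⟩ := continuousOn_iff'.1 hU O hO
    obtain ⟨x, hx⟩ := iInf_lt_iff.1 ha
    obtain ⟨⟨hxD, rfl⟩, hxa⟩ := iInf_lt_iff.1 hx
    have hxt : x ∈ t := (hte ▸ (⟨hy, hxD⟩ : x ∈ U ⁻¹' O ∩ D) : x ∈ t ∩ D).1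
    filter_upwards [h.lower t ht x hxt a hxa, eventually_ge_atTop 1] with n hn hn1
    refine hn.trans (measure_mono_ae ?_)
    filter_upwards [hB n hn1] with ω hω hωt
    exact (hte.symm ▸ (⟨hωt, hω⟩ : B n ω ∈ t ∩ D) : B n ω ∈ U ⁻¹' O ∩ D).1

end contraction

/-! ### Convolution powers, change of measure, law of large numbers -/

section convolution

variable {E : Type*} [NormedAddCommGroup E] [MeasurableSpace E] [BorelSpace E]
  [SecondCountableTopology E]

/-- The `n`-fold convolution of `μ` with itself. -/
noncomputable def convPow (μ : Measure E) : ℕ → Measure E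
  | 0 => Measure.dirac 0
  | n + 1 => (convPow μ n).conv μ

instance convPow.isProbabilityMeasure (μ : Measure E) [IsProbabilityMeasure μ] (n : ℕ) :
    IsProbabilityMeasure (convPow μ n) := by
  induction n with
  | zero => unfold convPow; infer_instance
  | succ n ih => unfold convPow; infer_instance

theorem lintegral_convPow_succ (μ : Measure E) [IsProbabilityMeasure μ] (n : ℕ) {g : E → ℝ≥0∞}
    (hg : Measurable g) :
    ∫⁻ s, g s ∂(convPow μ (n + 1)) = ∫⁻ s, ∫⁻ y, g (s + y) ∂μ ∂(convPow μ n) := by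
  rw [convPow, Measure.lintegral_conv hg]

theorem lintegral_convPow_of_map_add (μ : Measure E) [IsProbabilityMeasure μ] {φ : E → ℝ≥0∞}
    (hφ : Measurable φ) (h0 : φ 0 = 1) (hadd : ∀ s y, φ (s + y) = φ s * φ y) (n : ℕ) :
    ∫⁻ s, φ s ∂(convPow μ n) = (∫⁻ y, φ y ∂μ) ^ n := by
  induction n with
  | zero => simp [convPow, lintegral_dirac' _ hφ, h0]
  | succ n ih =>
    rw [lintegral_convPow_succ μ n hφ, pow_succ, ← ih, ← lintegral_mul_const _ hφ]
    simp_rw [hadd, lintegral_const_mul _ hφ]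

/-- A multiplicative density `φ` tensorizes. Quantifying over all test functions lets the induction
absorb the last summand into a new test function. The case `φ = 1` compares two laws; an exponential
`φ` undoes a tilt. -/
theorem lintegral_convPow_mul_le {μ τ : Measure E} [IsProbabilityMeasure μ]
    [IsProbabilityMeasure τ] {φ : E → ℝ≥0∞} (hφ : Measurable φ) (h0 : φ 0 = 1)
    (hadd : ∀ s y, φ (s + y) = φ s * φ y) {c : ℝ≥0∞}
    (h : ∀ g : E → ℝ≥0∞, Measurable g → c * ∫⁻ y, g y * φ y ∂τ ≤ ∫⁻ y, g y ∂μ) (n : ℕ) :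
    ∀ g : E → ℝ≥0∞, Measurable g →
      c ^ n * ∫⁻ s, g s * φ s ∂(convPow τ n) ≤ ∫⁻ s, g s ∂(convPow μ n) := by
  induction n with
  | zero =>
    intro g hg
    simp [convPow, lintegral_dirac' _ hg, h0]
  | succ n ih =>
    intro g hg
    have hin : ∀ s, Measurable fun y => g (s + y) := fun s => by fun_prop
    have hm : ∀ (ρ : Measure E) [IsProbabilityMeasure ρ] (f : E → ℝ≥0∞), Measurable f →
        Measurable fun s => ∫⁻ y, g (s + y) * f y ∂ρ := fun ρ _ f hf => by
      apply Measurable.lintegral_prod_right' (f := fun p : E × E => g (p.1 + p.2) * f p.2)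
      fun_prop
    have hm1 : Measurable fun s => ∫⁻ y, g (s + y) ∂μ := by
      simpa using hm μ 1 measurable_one
    have hpull : ∀ s, ∫⁻ y, g (s + y) * φ (s + y) ∂τ = (∫⁻ y, g (s + y) * φ y ∂τ) * φ s := by
      intro s
      rw [← lintegral_mul_const _ (by fun_prop)]
      refine lintegral_congr fun y => ?_
      rw [hadd]; ring
    rw [lintegral_convPow_succ τ n (g := fun s => g s * φ s) (hg.mul hφ),
      lintegral_convPow_succ μ n hg]
    simp_rw [hpull]
    have hm2 := (hm τ φ hφ).fun_mul hφ
    calc c ^ (n + 1) * ∫⁻ s, (∫⁻ y, g (s + y) * φ y ∂τ) * φ s ∂(convPow τ n)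
        = c ^ n * ∫⁻ s, (c * ∫⁻ y, g (s + y) * φ y ∂τ) * φ s ∂(convPow τ n) := by
          rw [pow_succ, mul_assoc, ← lintegral_const_mul _ hm2]
          simp_rw [mul_assoc]
      _ ≤ c ^ n * ∫⁻ s, (∫⁻ y, g (s + y) ∂μ) * φ s ∂(convPow τ n) := by
          gcongr with s
          exact h _ (hin s)
      _ ≤ _ := ih _ hm1

theorem convPow_le_of_le {μ τ : Measure E} [IsProbabilityMeasure μ] [IsProbabilityMeasure τ]
    {c : ℝ≥0∞} (h : c • τ ≤ μ) (n : ℕ) {A : Set E} (hA : MeasurableSet A) :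
    c ^ n * convPow τ n A ≤ convPow μ n A := by
  have := lintegral_convPow_mul_le (μ := μ) (τ := τ) (φ := 1) (c := c) measurable_one rfl
    (by simp) (fun g _ => by
      simpa [lintegral_smul_measure] using lintegral_mono' h (le_refl g)) n
    (A.indicator 1) (measurable_one.indicator hA)
  simpa [lintegral_indicator_one hA] using this

/-- Only the law of each sum matters, so the summands may change with `n`, as in a triangular array.
-/
theorem map_sum_eq_convPow {Ω : Type*} [MeasurableSpace Ω] {P : Measure Ω}
    [IsProbabilityMeasure P] {X : ℕ → Ω → E} {μ : Measure E} (hX : ∀ n, Measurable (X n))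
    (hind : iIndepFun X P) (hlaw : ∀ n, P.map (X n) = μ) (n : ℕ) :
    P.map (fun ω => ∑ i ∈ Finset.range n, X i ω) = convPow μ n := by
  induction n with
  | zero => simp [convPow]
  | succ n ih =>
    have hs : Measurable (∑ i ∈ Finset.range n, X i) := by fun_prop
    have h1 := (hind.indepFun_finsetSum_of_notMem hX
      (s := Finset.range n) (i := n) (by simp)).map_add_eq_map_conv_map hs (hX n)
    have h2 : (∑ i ∈ Finset.range n, X i) = fun ω => ∑ i ∈ Finset.range n, X i ω := by
      ext ω; simp
    rw [convPow, ← ih, ← hlaw n, ← h2, ← h1]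
    congr 1
    ext ω
    simp [Finset.sum_range_succ]

theorem tendsto_convPow_ball [NormedSpace ℝ E] [CompleteSpace E] (τ : Measure E)
    [IsProbabilityMeasure τ] (hint : Integrable id τ) {δ : ℝ} (hδ : 0 < δ) :
    Tendsto (fun n : ℕ => convPow τ n {s | (n : ℝ)⁻¹ • s ∈ Metric.ball (∫ y, y ∂τ) δ}) atTop
      (𝓝 1) := by
  -- Coordinates on the infinite product realise an i.i.d. sequence with law `τ`, to which the
  -- strong law applies.
  let Q : Measure (ℕ → E) := Measure.infinitePi fun _ => τ
  let Y : ℕ → (ℕ → E) → E := fun i ω => ω i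
  have hYm : ∀ i, Measurable (Y i) := fun i => measurable_pi_apply i
  have hYlaw : ∀ i, Q.map (Y i) = τ := fun i => Measure.infinitePi_map_eval (fun _ => τ) i
  have hYind : iIndepFun Y Q := iIndepFun_infinitePi (X := fun _ x => x) (by fun_prop)
  have hY0 : Integrable (Y 0) Q := by
    have : Integrable id (Q.map (Y 0)) := by rwa [hYlaw]
    exact this.comp_measurable (hYm 0)
  have hmean : ∫ ω, Y 0 ω ∂Q = ∫ y, y ∂τ := by
    rw [← hYlaw 0, integral_map (hYm 0).aemeasurable (by fun_prop)]
  have hlln := strong_law_ae Y hY0 (fun i j hij => hYind.indepFun hij)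
    (fun i => ⟨(hYm i).aemeasurable, (hYm 0).aemeasurable, by rw [hYlaw, hYlaw]⟩)
  rw [hmean] at hlln
  have hmeas := tendstoInMeasure_of_tendsto_ae
    (fun n => by
      apply Measurable.aestronglyMeasurable
      have : Measurable fun ω => ∑ i ∈ Finset.range n, Y i ω := by fun_prop
      fun_prop) hlln
  have hlim := tendstoInMeasure_iff_dist.1 hmeas δ hδ
  have hset : ∀ n : ℕ, MeasurableSet {s : E | (n : ℝ)⁻¹ • s ∈ Metric.ball (∫ y, y ∂τ) δ} := fun n =>
    (measurable_const_smul ((n : ℝ)⁻¹)) measurableSet_ball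
  have hcompl : Tendsto (fun n : ℕ =>
      convPow τ n {s | (n : ℝ)⁻¹ • s ∈ Metric.ball (∫ y, y ∂τ) δ}ᶜ) atTop (𝓝 0) := by
    refine hlim.congr fun n => ?_
    rw [← map_sum_eq_convPow hYm hYind hYlaw n, Measure.map_apply (by fun_prop) (hset n).compl]
    congr 1
    ext ω
    simp
  have := ENNReal.Tendsto.sub (tendsto_const_nhds (x := (1 : ℝ≥0∞))) hcompl (by simp)
  rw [tsub_zero] at this
  refine this.congr fun n => ?_
  rw [prob_compl_eq_one_sub (hset n), ENNReal.sub_sub_cancel (by simp) prob_le_one]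

end convolution

/-- Chernoff's bound: Markov's inequality for the exponential of `⟨θ, s⟩`, whose integral is the
`n`-th power of the moment generating function. If the latter is infinite, the half-space is empty.
-/
theorem convPow_halfspace_le {E : Type*} [NormedAddCommGroup E] [InnerProductSpace ℝ E]
    [MeasurableSpace E] [BorelSpace E] [SecondCountableTopology E] (μ : Measure E)
    [IsProbabilityMeasure μ] (θ : E) (a : ℝ) {n : ℕ} (hn : 0 < n) :
    convPow μ n {s | vecMgf id μ θ < ENNReal.ofReal (Real.exp (inner ℝ θ ((n : ℝ)⁻¹ • s) - a))} ≤
      ENNReal.ofReal (Real.exp (-(n * a))) := by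
  set L := vecMgf id μ θ with hL
  have hn' : (n : ℝ) ≠ 0 := by exact_mod_cast hn.ne'
  let φ : E → ℝ≥0∞ := fun s => ENNReal.ofReal (Real.exp (inner ℝ θ s))
  have hφ : Measurable φ := by fun_prop
  have hint : ∫⁻ s, φ s ∂(convPow μ n) = L ^ n :=
    lintegral_convPow_of_map_add μ hφ (by simp [φ])
      (fun s y => by simp [φ, inner_add_right, Real.exp_add, ENNReal.ofReal_mul, Real.exp_nonneg]) n
  have hL0 : L ≠ 0 := by
    rw [hL, vecMgf, Ne, lintegral_eq_zero_iff (by fun_prop)]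
    intro h
    have : ∀ᵐ x ∂μ, False := by
      filter_upwards [h] with x hx
      exact absurd (ENNReal.ofReal_eq_zero.1 hx) (not_le.2 (Real.exp_pos _))
    exact this.exists.elim fun _ hf => hf
  rcases eq_or_ne L ⊤ with hLt | hLt
  · simp [hLt]
  set A := {s | L < ENNReal.ofReal (Real.exp (inner ℝ θ ((n : ℝ)⁻¹ • s) - a))}
  have hsub : A ⊆ {s | L ^ n * ENNReal.ofReal (Real.exp (n * a)) ≤ φ s} := by
    intro s hs
    have h1 : L ^ n ≤ ENNReal.ofReal (Real.exp (inner ℝ θ s - n * a)) := by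
      calc L ^ n ≤ ENNReal.ofReal (Real.exp (inner ℝ θ ((n : ℝ)⁻¹ • s) - a)) ^ n :=
            pow_le_pow_left' (le_of_lt hs) n
        _ = _ := by
            rw [← ENNReal.ofReal_pow (Real.exp_nonneg _), ← Real.exp_nat_mul, inner_smul_right]
            congr 2
            field_simp
    calc L ^ n * ENNReal.ofReal (Real.exp (n * a))
        ≤ ENNReal.ofReal (Real.exp (inner ℝ θ s - n * a)) * ENNReal.ofReal (Real.exp (n * a)) := by
          gcongr
      _ = φ s := by
          rw [← ENNReal.ofReal_mul (Real.exp_nonneg _), ← Real.exp_add, sub_add_cancel]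
  have hmk := mul_meas_ge_le_lintegral (μ := convPow μ n) hφ
    (L ^ n * ENNReal.ofReal (Real.exp (n * a)))
  rw [hint, mul_assoc] at hmk
  have h1 : ENNReal.ofReal (Real.exp (n * a)) * convPow μ n A ≤ 1 := by
    have hp0 : L ^ n ≠ 0 := pow_ne_zero n hL0
    have hpt : L ^ n ≠ ⊤ := ENNReal.pow_ne_top hLt
    rw [← ENNReal.mul_le_mul_iff_right hp0 hpt, mul_one]
    refine le_trans ?_ hmk
    gcongr
  have he : ENNReal.ofReal (Real.exp (-(n * a))) = (ENNReal.ofReal (Real.exp (n * a)))⁻¹ := by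
    rw [Real.exp_neg, ENNReal.ofReal_inv_of_pos (Real.exp_pos _)]
  rw [he, ENNReal.le_inv_iff_mul_le, mul_comm]
  exact h1

/-! ### Truncated exponential tilts -/

section truncation

variable {E : Type*} [NormedAddCommGroup E] [InnerProductSpace ℝ E] [MeasurableSpace E]
  [BorelSpace E] [SecondCountableTopology E]

/-- The moment generating function of `μ` restricted to the ball of radius `M`. -/
noncomputable def truncMgf (μ : Measure E) (M : ℝ) (θ : E) : ℝ :=
  ∫ y in Metric.closedBall 0 M, Real.exp (inner ℝ θ y) ∂μ

theorem integrableOn_exp_inner_closedBall (μ : Measure E) [IsFiniteMeasure μ] (M : ℝ) (θ : E) :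
    IntegrableOn (fun y => Real.exp (inner ℝ θ y)) (Metric.closedBall 0 M) μ := by
  refine Measure.integrableOn_of_bounded (M := Real.exp (‖θ‖ * M)) (measure_ne_top _ _)
    (by fun_prop) ?_
  filter_upwards [ae_restrict_mem Metric.isClosed_closedBall.measurableSet] with y hy
  rw [Real.norm_eq_abs, Real.abs_exp]
  gcongr
  exact (real_inner_le_norm θ y).trans (by gcongr; simpa using hy)

theorem truncMgf_pos {μ : Measure E} [IsFiniteMeasure μ] {M : ℝ}
    (hM : μ (Metric.closedBall 0 M) ≠ 0) (θ : E) : 0 < truncMgf μ M θ := by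
  have : NeZero (μ.restrict (Metric.closedBall 0 M)) := ⟨by simpa using hM⟩
  exact integral_exp_pos (integrableOn_exp_inner_closedBall μ M θ)

theorem truncMgf_mono (μ : Measure E) [IsFiniteMeasure μ] {M N : ℝ} (h : M ≤ N) (θ : E) :
    truncMgf μ M θ ≤ truncMgf μ N θ :=
  setIntegral_mono_set (integrableOn_exp_inner_closedBall μ N θ)
    (ae_of_all _ fun _ => (Real.exp_pos _).le) (Metric.closedBall_subset_closedBall h).eventuallyLE

/-- On the ball of radius `M`, moving `θ` changes the exponent by at most `M` times the
displacement. -/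
theorem log_truncMgf_le {μ : Measure E} [IsFiniteMeasure μ] {M : ℝ}
    (hM : μ (Metric.closedBall 0 M) ≠ 0) (θ η : E) :
    Real.log (truncMgf μ M θ) ≤ Real.log (truncMgf μ M η) + M * ‖θ - η‖ := by
  have h : truncMgf μ M θ ≤ truncMgf μ M η * Real.exp (M * ‖θ - η‖) := by
    unfold truncMgf
    rw [← integral_mul_const]
    refine setIntegral_mono_on (integrableOn_exp_inner_closedBall μ M θ)
      ((integrableOn_exp_inner_closedBall μ M η).mul_const _)
      Metric.isClosed_closedBall.measurableSet fun y hy => ?_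
    rw [← Real.exp_add]
    gcongr
    have h1 : inner ℝ θ y = inner ℝ η y + inner ℝ (θ - η) y := by
      rw [inner_sub_left]; ring
    rw [h1, mul_comm M]
    gcongr
    exact (real_inner_le_norm _ y).trans (by gcongr; simpa using hy)
  calc Real.log (truncMgf μ M θ) ≤ Real.log (truncMgf μ M η * Real.exp (M * ‖θ - η‖)) :=
        Real.log_le_log (truncMgf_pos hM θ) h
    _ = _ := by
        rw [Real.log_mul (truncMgf_pos hM η).ne' (Real.exp_pos _).ne', Real.log_exp]

theorem continuous_log_truncMgf {μ : Measure E} [IsFiniteMeasure μ] {M : ℝ}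
    (hM : μ (Metric.closedBall 0 M) ≠ 0) : Continuous fun θ => Real.log (truncMgf μ M θ) := by
  have : LipschitzWith M.toNNReal fun θ => Real.log (truncMgf μ M θ) := by
    refine LipschitzWith.of_le_add_mul _ fun θ η => (log_truncMgf_le hM θ η).trans ?_
    rw [dist_eq_norm]
    gcongr
    exact Real.le_coe_toNNReal M
  exact this.continuous

omit [BorelSpace E] [SecondCountableTopology E] in
theorem truncMgf_zero_le_one (μ : Measure E) [IsProbabilityMeasure μ] (M : ℝ) :
    truncMgf μ M 0 ≤ 1 := by
  simp [truncMgf, measureReal_le_one]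

/-- Monotone convergence over growing balls; an infinite moment generating function is allowed. -/
theorem exists_lt_truncMgf (μ : Measure E) [IsFiniteMeasure μ] {θ : E} {b : ℝ}
    (h : ENNReal.ofReal b < vecMgf id μ θ) : ∃ k : ℕ, b < truncMgf μ k θ := by
  have hmono : Monotone fun k : ℕ => Metric.closedBall (0 : E) (k : ℝ) := fun k l hkl =>
    Metric.closedBall_subset_closedBall (by exact_mod_cast hkl)
  have hsup : vecMgf id μ θ =
      ⨆ k : ℕ, ∫⁻ y in Metric.closedBall 0 (k : ℝ), ENNReal.ofReal (Real.exp (inner ℝ θ y)) ∂μ := by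
    rw [← setLIntegral_iUnion_of_directed _ hmono.directed_le, Metric.iUnion_closedBall_nat,
      Measure.restrict_univ]
    rfl
  rw [hsup] at h
  obtain ⟨k, hk⟩ := lt_iSup_iff.1 h
  refine ⟨k, ?_⟩
  rw [← ofReal_integral_eq_lintegral_ofReal (integrableOn_exp_inner_closedBall μ k θ)
    (ae_of_all _ fun _ => (Real.exp_pos _).le)] at hk
  exact (ENNReal.ofReal_lt_ofReal_iff'.1 hk).1

/-- The exponential tilt of `μ` restricted to the ball of radius `M`. -/
noncomputable def truncTilt (μ : Measure E) (M : ℝ) (θ : E) : Measure E :=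
  (μ.restrict (Metric.closedBall 0 M)).tilted fun y => inner ℝ θ y

theorem isProbabilityMeasure_truncTilt {μ : Measure E} [IsFiniteMeasure μ] {M : ℝ}
    (hM : μ (Metric.closedBall 0 M) ≠ 0) (θ : E) : IsProbabilityMeasure (truncTilt μ M θ) := by
  have : NeZero (μ.restrict (Metric.closedBall 0 M)) := ⟨by simpa using hM⟩
  exact isProbabilityMeasure_tilted (integrableOn_exp_inner_closedBall μ M θ)

omit [SecondCountableTopology E] in
theorem ae_norm_le_truncTilt (μ : Measure E) (M : ℝ) (θ : E) :
    ∀ᵐ y ∂(truncTilt μ M θ), ‖y‖ ≤ M := by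
  refine (tilted_absolutelyContinuous _ _).ae_le ?_
  filter_upwards [ae_restrict_mem Metric.isClosed_closedBall.measurableSet] with y hy
  simpa using hy

theorem integrable_id_truncTilt {μ : Measure E} [IsFiniteMeasure μ] {M : ℝ}
    (hM : μ (Metric.closedBall 0 M) ≠ 0) (θ : E) : Integrable id (truncTilt μ M θ) := by
  have := isProbabilityMeasure_truncTilt hM θ
  exact Integrable.of_bound (by fun_prop) M (ae_norm_le_truncTilt μ M θ)

/-- Up to a constant, the function of `t` is the cumulant generating function of `⟨v, ·⟩` under the
tilted law, and its derivative at `0` is the mean. -/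
theorem hasDerivAt_log_truncMgf [CompleteSpace E] {μ : Measure E} [IsFiniteMeasure μ] {M : ℝ}
    (hM : μ (Metric.closedBall 0 M) ≠ 0) (θ v : E) :
    HasDerivAt (fun t : ℝ => Real.log (truncMgf μ M (θ + t • v)))
      (inner ℝ v (∫ y, y ∂(truncTilt μ M θ))) 0 := by
  have := isProbabilityMeasure_truncTilt hM θ
  set τ := truncTilt μ M θ with hτ
  let X : E → ℝ := fun y => inner ℝ v y
  have hset : integrableExpSet X τ = Set.univ := by
    ext t
    simp only [integrableExpSet, Set.mem_ofPred_eq, Set.mem_univ, iff_true]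
    refine Integrable.of_bound (by fun_prop) (Real.exp (|t| * (‖v‖ * M))) ?_
    filter_upwards [ae_norm_le_truncTilt μ M θ] with y hy
    rw [Real.norm_eq_abs, Real.abs_exp]
    refine Real.exp_le_exp.2 ((le_abs_self _).trans ?_)
    rw [abs_mul]
    gcongr
    exact (abs_real_inner_le_norm v y).trans (by gcongr)
  have h0 : (0 : ℝ) ∈ interior (integrableExpSet X τ) := by simp [hset]
  have hder := (analyticAt_cgf h0).differentiableAt.hasDerivAt
  rw [deriv_cgf_zero h0] at hder
  have hmean : (∫ y, X y ∂τ) / τ.real Set.univ = inner ℝ v (∫ y, y ∂τ) := by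
    simp only [probReal_univ, div_one]
    exact integral_inner (integrable_id_truncTilt hM θ) v
  rw [hmean] at hder
  have heq : (fun t : ℝ => Real.log (truncMgf μ M (θ + t • v))) =
      fun t => Real.log (truncMgf μ M θ) + cgf X τ t := by
    funext t
    have h1 : mgf X τ t = truncMgf μ M (θ + t • v) / truncMgf μ M θ := by
      rw [mgf, hτ, truncTilt, integral_exp_tilted]
      simp only [truncMgf, inner_add_left, inner_smul_left, Pi.add_apply]
      rfl
    rw [cgf, h1, Real.log_div (truncMgf_pos hM _).ne' (truncMgf_pos hM _).ne']
    ring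
  rw [heq]
  exact hder.const_add _

theorem tendsto_quadratic_atTop (c b : ℝ) {ε : ℝ} (hε : 0 < ε) :
    Tendsto (fun t : ℝ => c + t * (ε * t - b)) atTop atTop :=
  tendsto_atTop_add_const_left _ _ (tendsto_id.atTop_mul_atTop₀
    (tendsto_atTop_add_const_right _ _ (tendsto_id.const_mul_atTop hε)))

/-- The quadratic penalty beats the linear lower bound on the other terms. It forces a minimizer
even when `x` is outside the convex hull of the truncated support. -/
theorem tendsto_regularized_cocompact [FiniteDimensional ℝ E] {μ : Measure E} [IsFiniteMeasure μ]
    {M : ℝ} (hM : μ (Metric.closedBall 0 M) ≠ 0) (x : E) {ε : ℝ} (hε : 0 < ε) :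
    Tendsto (fun θ => Real.log (truncMgf μ M θ) - inner ℝ θ x + ε * ‖θ‖ ^ 2)
      (cocompact E) atTop := by
  have : ProperSpace E := FiniteDimensional.proper ℝ E
  refine tendsto_atTop_mono (fun θ => ?_) ((tendsto_quadratic_atTop
    (Real.log (truncMgf μ M 0)) (M + ‖x‖) hε).comp (tendsto_norm_cocompact_atTop (E := E)))
  have h1 := log_truncMgf_le hM 0 θ
  have h2 := real_inner_le_norm θ x
  rw [zero_sub, norm_neg] at h1
  simp only [Function.comp]
  nlinarith

/-- Minimize `J = log Z - ⟨θ, x⟩ + ε ‖θ‖ ^ 2`, with `Z` the truncated generating function. At the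
minimizer the tilted mean is `x - 2 ε θ`, and `ε ‖θ‖ ^ 2 < a` keeps it near `x`. -/
theorem exists_truncTilt [FiniteDimensional ℝ E] (μ : Measure E) [IsProbabilityMeasure μ] {x : E}
    {a : ℝ} (hx : ∀ θ, ENNReal.ofReal (Real.exp (inner ℝ θ x - a)) < vecMgf id μ θ) {r : ℝ}
    (hr : 0 < r) :
    ∃ (M : ℝ) (θ : E), μ (Metric.closedBall 0 M) ≠ 0 ∧ ‖(∫ y, y ∂(truncTilt μ M θ)) - x‖ < r ∧
      inner ℝ θ (∫ y, y ∂(truncTilt μ M θ)) - Real.log (truncMgf μ M θ) < a := by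
  have : CompleteSpace E := FiniteDimensional.complete ℝ E
  have ha : 0 < a := by
    have := hx 0
    simpa [vecMgf] using this
  -- Chosen so that `(2 ε ‖θ‖) ^ 2 < 4 ε a = r ^ 2 / 2`.
  let ε := r ^ 2 / (8 * a)
  have hε : 0 < ε := by positivity
  have hk : ∀ θ, ∃ k : ℕ, Real.exp (inner ℝ θ x - a) < truncMgf μ k θ := fun θ =>
    exists_lt_truncMgf μ (hx θ)
  obtain ⟨k₀, hk₀⟩ := hk 0
  have hM₀ : μ (Metric.closedBall 0 (k₀ : ℝ)) ≠ 0 := by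
    intro h
    have : truncMgf μ k₀ 0 = 0 := by
      rw [truncMgf, Measure.restrict_eq_zero.2 h, integral_zero_measure]
    rw [this] at hk₀
    exact absurd hk₀ (not_lt.2 (Real.exp_pos _).le)
  have hM : ∀ k : ℕ, k₀ ≤ k → μ (Metric.closedBall 0 (k : ℝ)) ≠ 0 := fun k hkk h =>
    hM₀ (measure_mono_null (Metric.closedBall_subset_closedBall (by exact_mod_cast hkk)) h)
  let J : ℕ → E → ℝ := fun k θ => Real.log (truncMgf μ k θ) - inner ℝ θ x + ε * ‖θ‖ ^ 2
  have hJc : ∀ k, k₀ ≤ k → Continuous (J k) := fun k hkk => by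
    have := continuous_log_truncMgf (hM k hkk)
    fun_prop
  -- Since `J k` increases with `k`, this compact set contains the minimizers of all later `J k`. By
  -- compactness, one radius makes the strict bound `hx` survive truncation on all of it.
  have hK : IsCompact {θ | J k₀ θ ≤ 0} := by
    have := (tendsto_regularized_cocompact hM₀ x hε).eventually_gt_atTop 0
    obtain ⟨t, ht, hts⟩ := mem_cocompact.1 this
    refine ht.of_isClosed_subset (isClosed_le (hJc k₀ le_rfl) continuous_const) fun θ hθ => ?_
    by_contra hθt
    exact not_lt.2 hθ (show 0 < J k₀ θ from hts hθt)
  have hmono : ∀ k l : ℕ, k₀ ≤ k → k ≤ l → ∀ θ,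
      Real.log (truncMgf μ k θ) ≤ Real.log (truncMgf μ l θ) := fun k l hkk hkl θ =>
    Real.log_le_log (truncMgf_pos (hM k hkk) θ) (truncMgf_mono μ (by exact_mod_cast hkl) θ)
  let V : ℕ → Set E := fun k => {θ | inner ℝ θ x - a < Real.log (truncMgf μ ↑(k₀ + k) θ)}
  have hV : Monotone V := fun k l hkl θ hθ =>
    lt_of_lt_of_le hθ (hmono _ _ (by omega) (by omega) θ)
  obtain ⟨k₁, hk₁⟩ := hK.elim_directed_cover V
    (fun k => by
      have := continuous_log_truncMgf (hM (k₀ + k) (by omega))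
      exact isOpen_lt (by fun_prop) this)
    (fun θ _ => by
      obtain ⟨k, hk⟩ := hk θ
      refine Set.mem_iUnion.2 ⟨k, ?_⟩
      have h1 : Real.exp (inner ℝ θ x - a) < truncMgf μ ↑(k₀ + k) θ :=
        hk.trans_le (truncMgf_mono μ (by exact_mod_cast Nat.le_add_left k k₀) θ)
      exact (Real.lt_log_iff_exp_lt ((Real.exp_pos _).trans h1)).2 h1)
    hV.directed_le
  set k := k₀ + k₁ with hkdef
  have hkk : k₀ ≤ k := by omega
  obtain ⟨θ, hθ⟩ := (hJc k hkk).exists_forall_le (tendsto_regularized_cocompact (hM k hkk) x hε)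
  have hJ0 : J k θ ≤ 0 := by
    refine (hθ 0).trans ?_
    simpa [J] using Real.log_nonpos (truncMgf_pos (hM k hkk) 0).le (truncMgf_zero_le_one μ k)
  have hθK : inner ℝ θ x - a < Real.log (truncMgf μ k θ) := by
    apply hk₁
    refine le_trans ?_ hJ0
    have := hmono k₀ k le_rfl hkk θ
    simp only [J]
    linarith
  -- First-order condition at the minimizer, in every direction `v`.
  have hmean : (∫ y, y ∂(truncTilt μ k θ)) = x - (2 * ε) • θ := by
    refine ext_inner_left ℝ fun v => ?_
    have hd : HasDerivAt (fun t : ℝ => J k (θ + t • v))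
        (inner ℝ v (∫ y, y ∂(truncTilt μ k θ)) - inner ℝ v x + ε * (2 * inner ℝ θ v)) 0 := by
      have h1 := hasDerivAt_log_truncMgf (hM k hkk) θ v
      have h2 : HasDerivAt (fun t : ℝ => (inner ℝ (θ + t • v) x : ℝ)) (inner ℝ v x) 0 := by
        have := ((hasDerivAt_id (0 : ℝ)).mul_const (inner ℝ v x)).const_add (inner ℝ θ x)
        simpa [inner_add_left, inner_smul_left] using this
      have h3 : HasDerivAt (fun t : ℝ => ‖θ + t • v‖ ^ 2) (2 * inner ℝ θ v) 0 := by
        have := (((hasDerivAt_id (0 : ℝ)).smul_const v).const_add θ).norm_sq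
        simpa using this
      exact (h1.sub h2).add (h3.const_mul ε)
    have hmin : IsLocalMin (fun t : ℝ => J k (θ + t • v)) 0 :=
      Filter.Eventually.of_forall fun t => by simpa using hθ (θ + t • v)
    have := hmin.hasDerivAt_eq_zero hd
    rw [inner_sub_right, inner_smul_right, real_inner_comm θ v]
    linarith
  refine ⟨k, θ, hM k hkk, ?_, ?_⟩
  · rw [hmean, sub_sub_cancel_left, norm_neg, norm_smul, Real.norm_of_nonneg (by positivity)]
    have h1 : ε * ‖θ‖ ^ 2 < a := by
      simp only [J] at hJ0
      linarith
    refine lt_of_pow_lt_pow_left₀ 2 hr.le ?_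
    calc (2 * ε * ‖θ‖) ^ 2 = 4 * ε * (ε * ‖θ‖ ^ 2) := by ring
      _ < 4 * ε * a := by gcongr
      _ = r ^ 2 / 2 := by simp only [ε]; field_simp; norm_num
      _ ≤ r ^ 2 := by linarith [sq_nonneg r]
  · rw [hmean, inner_sub_right, inner_smul_right, real_inner_self_eq_norm_sq]
    nlinarith [sq_nonneg ‖θ‖]

end truncation

/-! ### Subexponential comparison and logarithm-free inequalities -/

theorem ExponentialBounds.of_comparable {E : Type*} [TopologicalSpace E] [MeasurableSpace E]
    [OpensMeasurableSpace E] {Q Q' : ℕ → Set E → ℝ≥0∞} {I : E → EReal}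
    (h : ExponentialBounds Q I)
    (hle : ∀ ε : ℝ, 0 < ε → ∀ᶠ n : ℕ in atTop, ∀ A, MeasurableSet A →
      ENNReal.ofReal (Real.exp (-(n * ε))) * Q' n A ≤ Q n A)
    (hge : ∀ ε : ℝ, 0 < ε → ∀ᶠ n : ℕ in atTop, ∀ A, MeasurableSet A →
      ENNReal.ofReal (Real.exp (-(n * ε))) * Q n A ≤ Q' n A) :
    ExponentialBounds Q' I where
  upper C hC a ha := by
    obtain ⟨b, hab, hb⟩ := EReal.lt_iff_exists_real_btwn.1 ha
    have hab : a < b := by exact_mod_cast hab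
    filter_upwards [h.upper C hC b hb, hle (b - a) (sub_pos.2 hab)] with n h1 h2
    have h3 := (h2 C hC.measurableSet).trans h1
    have h4 : ENNReal.ofReal (Real.exp (-(n * b))) =
        ENNReal.ofReal (Real.exp (-(n * (b - a)))) * ENNReal.ofReal (Real.exp (-(n * a))) := by
      rw [← ENNReal.ofReal_mul (Real.exp_nonneg _), ← Real.exp_add]
      ring_nf
    rw [h4] at h3
    exact (ENNReal.mul_le_mul_iff_right (by simp [Real.exp_pos]) (by simp)).1 h3
  lower O hO x hx a ha := by
    obtain ⟨b, hb, hab⟩ := EReal.lt_iff_exists_real_btwn.1 ha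
    have hab : b < a := by exact_mod_cast hab
    filter_upwards [h.lower O hO x hx b hb, hge (a - b) (sub_pos.2 hab)] with n h1 h2
    refine le_trans ?_ (h2 O hO.measurableSet)
    refine le_trans (le_of_eq ?_) (mul_le_mul_right h1 _)
    rw [← ENNReal.ofReal_mul (Real.exp_nonneg _), ← Real.exp_add]
    ring_nf

theorem coe_sub_log_lt_iff {u a : ℝ} {L : ℝ≥0∞} :
    (u : EReal) - ENNReal.log L < (a : EReal) ↔ ENNReal.ofReal (Real.exp (u - a)) < L := by
  rw [← EReal.exp_coe, ← ENNReal.log_lt_log_iff, EReal.log_exp]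
  induction ENNReal.log L with
  | bot => simp
  | top => simpa using EReal.coe_lt_top (u - a)
  | coe l => norm_cast; rw [sub_lt_comm]

theorem lt_coe_sub_log_iff {u a : ℝ} {L : ℝ≥0∞} :
    (a : EReal) < (u : EReal) - ENNReal.log L ↔ L < ENNReal.ofReal (Real.exp (u - a)) := by
  rw [← EReal.exp_coe, ← ENNReal.log_lt_log_iff, EReal.log_exp]
  induction ENNReal.log L with
  | bot => simpa using EReal.bot_lt_coe (u - a)
  | top => simp
  | coe l => norm_cast; rw [lt_sub_comm]

/-! ### Cramér's theorem -/

section cramer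

variable {E : Type*} [NormedAddCommGroup E] [InnerProductSpace ℝ E] [FiniteDimensional ℝ E]
  [MeasurableSpace E] [BorelSpace E]

/-- The rate function of Cramér's theorem for the law `μ`. -/
noncomputable def cramerRate (μ : Measure E) : E → EReal :=
  legendreTransform fun θ => ENNReal.log (vecMgf id μ θ)

omit [FiniteDimensional ℝ E] [BorelSpace E] in
theorem lt_cramerRate_iff {μ : Measure E} {x : E} {a : ℝ} :
    (a : EReal) < cramerRate μ x ↔
      ∃ θ, vecMgf id μ θ < ENNReal.ofReal (Real.exp (inner ℝ θ x - a)) := by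
  simp only [cramerRate, legendreTransform, lt_iSup_iff, lt_coe_sub_log_iff]

omit [FiniteDimensional ℝ E] [BorelSpace E] in
theorem lt_vecMgf_of_cramerRate_lt {μ : Measure E} {x : E} {a : ℝ} (h : cramerRate μ x < a)
    (θ : E) : ENNReal.ofReal (Real.exp (inner ℝ θ x - a)) < vecMgf id μ θ :=
  coe_sub_log_lt_iff.1 (lt_of_le_of_lt
    (le_iSup (fun θ : E => ((inner ℝ θ x : ℝ) : EReal) - ENNReal.log (vecMgf id μ θ)) θ) h)

omit [FiniteDimensional ℝ E] [BorelSpace E] in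
theorem cramerRate_nonneg (μ : Measure E) [IsProbabilityMeasure μ] (x : E) :
    0 ≤ cramerRate μ x := by
  refine le_trans (le_of_eq ?_)
    (le_iSup (fun θ : E => ((inner ℝ θ x : ℝ) : EReal) - ENNReal.log (vecMgf id μ θ)) 0)
  simp [vecMgf]

omit [BorelSpace E] in
-- Exponential tightness: small multiples of plus and minus an orthonormal basis have finite
-- generating function, and bound each coordinate from both sides. The same `T` serves every `a`.
theorem exists_finset_isBounded {μ : Measure E} (h : ∀ᶠ θ in 𝓝 (0 : E), vecMgf id μ θ < ⊤) :
    ∃ T : Finset E, ∀ a : ℝ, Bornology.IsBounded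
      {x : E | ∀ θ ∈ T, ENNReal.ofReal (Real.exp (inner ℝ θ x - a)) ≤ vecMgf id μ θ} := by
  classical
  obtain ⟨ρ, hρ, hball⟩ := Metric.eventually_nhds_iff_ball.1 h
  let b := stdOrthonormalBasis ℝ E
  let t := ρ / 2
  have ht : 0 < t := by positivity
  have hfin : ∀ i, vecMgf id μ (t • b i) < ⊤ ∧ vecMgf id μ (-(t • b i)) < ⊤ := by
    intro i
    have : ‖t • b i‖ < ρ := by
      rw [norm_smul, b.norm_eq_one, Real.norm_of_nonneg ht.le]
      simp only [t]; linarith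
    exact ⟨hball _ (by simpa using this), hball _ (by simpa using this)⟩
  refine ⟨Finset.univ.image (fun i => t • b i) ∪ Finset.univ.image (fun i => -(t • b i)),
    fun a => ?_⟩
  have hbound : ∀ θ x : E, vecMgf id μ θ < ⊤ →
      ENNReal.ofReal (Real.exp (inner ℝ θ x - a)) ≤ vecMgf id μ θ →
      inner ℝ θ x ≤ a + (vecMgf id μ θ).toReal := by
    intro θ x hθ hle
    have h1 := (ENNReal.ofReal_le_iff_le_toReal hθ.ne).1 hle
    have h2 := Real.add_one_le_exp (inner ℝ θ x - a)
    linarith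
  let R := fun i => (|a| + (vecMgf id μ (t • b i)).toReal + (vecMgf id μ (-(t • b i))).toReal) / t
  refine isBounded_iff_forall_norm_le.2 ⟨∑ i, R i, fun x hx => ?_⟩
  calc ‖x‖ = ‖∑ i, (inner ℝ (b i) x : ℝ) • b i‖ := by rw [b.sum_repr' x]
    _ ≤ ∑ i, ‖(inner ℝ (b i) x : ℝ) • b i‖ := norm_sum_le _ _
    _ ≤ ∑ i, R i := by
        refine Finset.sum_le_sum fun i _ => ?_
        rw [norm_smul, b.norm_eq_one, mul_one, Real.norm_eq_abs]
        have h1 := hbound _ x (hfin i).1 (hx _ (by simp))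
        have h2 := hbound _ x (hfin i).2 (hx _ (by simp))
        rw [inner_neg_left] at h2
        rw [inner_smul_left] at h1 h2
        simp only [conj_trivial] at h1 h2
        rw [le_div_iff₀ ht, ← abs_of_pos ht, ← abs_mul, abs_le]
        have h3 := le_abs_self a
        have h4 : 0 ≤ (vecMgf id μ (t • b i)).toReal := ENNReal.toReal_nonneg
        have h5 : 0 ≤ (vecMgf id μ (-(t • b i))).toReal := ENNReal.toReal_nonneg
        rw [abs_of_pos ht]
        constructor <;> linarith

omit [BorelSpace E] in
theorem isGoodRateFunction_cramerRate (μ : Measure E) [IsProbabilityMeasure μ]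
    (h : ∀ᶠ θ in 𝓝 (0 : E), vecMgf id μ θ < ⊤) : IsGoodRateFunction (cramerRate μ) := by
  have : ProperSpace E := FiniteDimensional.proper ℝ E
  refine isGoodRateFunction_of_isCompact_level (cramerRate_nonneg μ) fun η => ?_
  obtain ⟨T, hT⟩ := exists_finset_isBounded h
  have heq : {x | cramerRate μ x ≤ (η : EReal)} =
      ⋂ θ, {x : E | ENNReal.ofReal (Real.exp (inner ℝ θ x - η)) ≤ vecMgf id μ θ} := by
    ext x
    have := (lt_cramerRate_iff (μ := μ) (x := x) (a := η)).not
    simpa using this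
  rw [heq]
  refine Metric.isCompact_of_isClosed_isBounded
    (isClosed_iInter fun θ => isClosed_le (ENNReal.continuous_ofReal.comp (by fun_prop)) continuous_const) ((hT η).subset ?_)
  intro x hx θ _
  exact Set.mem_iInter.1 hx θ

theorem convPow_isClosed_le {μ : Measure E} [IsProbabilityMeasure μ]
    (h : ∀ᶠ θ in 𝓝 (0 : E), vecMgf id μ θ < ⊤) {C : Set E} (hC : IsClosed C) {a : ℝ}
    (ha : ∀ x ∈ C, (a : EReal) < cramerRate μ x) :
    ∃ N : ℕ, ∀ n : ℕ, 0 < n →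
      convPow μ n {s | (n : ℝ)⁻¹ • s ∈ C} ≤ N * ENNReal.ofReal (Real.exp (-(n * a))) := by
  classical
  have : ProperSpace E := FiniteDimensional.proper ℝ E
  obtain ⟨T, hT⟩ := exists_finset_isBounded h
  let H : E → Set E := fun θ =>
    {x | vecMgf id μ θ < ENNReal.ofReal (Real.exp (inner ℝ θ x - a))}
  have hH : ∀ θ, IsOpen (H θ) := fun θ => isOpen_lt continuous_const (ENNReal.continuous_ofReal.comp (by fun_prop))
  -- The part of `C` missed by the half-spaces of `T` is bounded, hence compact.
  let K := C ∩ {x : E | ∀ θ ∈ T, ENNReal.ofReal (Real.exp (inner ℝ θ x - a)) ≤ vecMgf id μ θ}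
  have hK : IsCompact K := by
    refine Metric.isCompact_of_isClosed_isBounded (hC.inter ?_) ((hT a).subset
      Set.inter_subset_right)
    have : {x : E | ∀ θ ∈ T, ENNReal.ofReal (Real.exp (inner ℝ θ x - a)) ≤ vecMgf id μ θ} =
        ⋂ θ ∈ T, (H θ)ᶜ := by
      ext x; simp [H]
    rw [this]
    exact isClosed_biInter fun θ _ => (hH θ).isClosed_compl
  obtain ⟨S, hS⟩ := hK.elim_finite_subcover H hH fun x hx =>
    Set.mem_iUnion.2 (lt_cramerRate_iff.1 (ha x hx.1))
  have hcover : C ⊆ ⋃ θ ∈ S ∪ T, H θ := by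
    intro x hx
    by_cases hxT : ∀ θ ∈ T, ENNReal.ofReal (Real.exp (inner ℝ θ x - a)) ≤ vecMgf id μ θ
    · obtain ⟨θ, hθ, hxθ⟩ := Set.mem_iUnion₂.1 (hS ⟨hx, hxT⟩)
      exact Set.mem_iUnion₂.2 ⟨θ, Finset.mem_union_left _ hθ, hxθ⟩
    · push Not at hxT
      obtain ⟨θ, hθ, hxθ⟩ := hxT
      exact Set.mem_iUnion₂.2 ⟨θ, Finset.mem_union_right _ hθ, hxθ⟩
  refine ⟨(S ∪ T).card, fun n hn => ?_⟩
  calc convPow μ n {s | (n : ℝ)⁻¹ • s ∈ C}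
      ≤ convPow μ n (⋃ θ ∈ S ∪ T, {s | (n : ℝ)⁻¹ • s ∈ H θ}) := by
        refine measure_mono fun s hs => ?_
        simpa using hcover hs
    _ ≤ ∑ θ ∈ S ∪ T, convPow μ n {s | (n : ℝ)⁻¹ • s ∈ H θ} := measure_biUnion_finset_le _ _
    _ ≤ ∑ θ ∈ S ∪ T, ENNReal.ofReal (Real.exp (-(n * a))) :=
        Finset.sum_le_sum fun θ _ => convPow_halfspace_le μ θ a hn
    _ = _ := by simp

/-- The tilted law gives a small ball around its mean a mass tending to `1`; on that ball the
density of the change of measure is almost constant. -/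
theorem le_convPow_ball {μ : Measure E} [IsProbabilityMeasure μ] {x : E} {a b r : ℝ}
    (hx : cramerRate μ x < a) (hab : a < b) (hr : 0 < r) :
    ∀ᶠ n : ℕ in atTop, ENNReal.ofReal (Real.exp (-(n * b))) ≤
      convPow μ n {s | (n : ℝ)⁻¹ • s ∈ Metric.ball x r} := by
  have : CompleteSpace E := FiniteDimensional.complete ℝ E
  obtain ⟨M, θ, hM, hmx, hcost⟩ :=
    exists_truncTilt μ (lt_vecMgf_of_cramerRate_lt hx) (half_pos hr)
  have := isProbabilityMeasure_truncTilt hM θ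
  set τ := truncTilt μ M θ with hτ
  set m := ∫ y, y ∂τ
  set Z := truncMgf μ M θ with hZ
  have hZpos : 0 < Z := truncMgf_pos hM θ
  -- Half of the slack pays for the variation of `⟨θ, ·⟩` on the ball, half for the factor `exp
  -- (-d)` bounding its tilted mass from below.
  let d := (b - a) / 2
  have hd : 0 < d := half_pos (sub_pos.2 hab)
  let δ := min (r / 2) (d / (‖θ‖ + 1))
  have hδ : 0 < δ := by positivity
  have hθδ : ‖θ‖ * δ ≤ d := by
    calc ‖θ‖ * δ ≤ (‖θ‖ + 1) * (d / (‖θ‖ + 1)) := by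
          gcongr
          · linarith
          · exact min_le_right _ _
      _ = d := by field_simp
  let φ : E → ℝ≥0∞ := fun s => ENNReal.ofReal (Real.exp (-inner ℝ θ s))
  have hφ : Measurable φ := by fun_prop
  have hdens : ∀ g : E → ℝ≥0∞, Measurable g →
      ENNReal.ofReal Z * ∫⁻ y, g y * φ y ∂τ ≤ ∫⁻ y, g y ∂μ := by
    intro g hg
    rw [hτ, truncTilt, lintegral_tilted, ← lintegral_const_mul _ (by fun_prop)]
    refine le_trans (le_of_eq ?_) (setLIntegral_le_lintegral (Metric.closedBall 0 M) g)
    refine lintegral_congr fun y => ?_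
    change ENNReal.ofReal Z * (ENNReal.ofReal (Real.exp (inner ℝ θ y) / Z) * (g y * φ y)) = g y
    have : ENNReal.ofReal Z * ENNReal.ofReal (Real.exp (inner ℝ θ y) / Z) * φ y = 1 := by
      rw [← ENNReal.ofReal_mul hZpos.le, ← ENNReal.ofReal_mul (by positivity),
        mul_div_cancel₀ _ hZpos.ne', ← Real.exp_add, add_neg_cancel, Real.exp_zero,
        ENNReal.ofReal_one]
    calc _ = (ENNReal.ofReal Z * ENNReal.ofReal (Real.exp (inner ℝ θ y) / Z) * φ y) * g y := by
          ring
      _ = g y := by rw [this, one_mul]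
  have hconv := lintegral_convPow_mul_le hφ (by simp [φ])
    (fun s y => by
      simp only [φ]
      rw [inner_add_right, neg_add, Real.exp_add, ENNReal.ofReal_mul (Real.exp_nonneg _)]) hdens
  have hlln := tendsto_convPow_ball τ (integrable_id_truncTilt hM θ) hδ
  have hlt : ENNReal.ofReal (Real.exp (-d)) < 1 := by simpa using hd
  filter_upwards [hlln.eventually (eventually_gt_nhds hlt), eventually_ge_atTop 1] with n hn hn1
  have hn1' : (1 : ℝ) ≤ n := by exact_mod_cast hn1
  set A := {s : E | (n : ℝ)⁻¹ • s ∈ Metric.ball m δ} with hA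
  have hAm : MeasurableSet A := (measurable_const_smul ((n : ℝ)⁻¹)) measurableSet_ball
  have hAsub : A ⊆ {s | (n : ℝ)⁻¹ • s ∈ Metric.ball x r} := fun s hs => by
    refine Metric.ball_subset_ball' ?_ hs
    rw [dist_eq_norm]
    have : δ ≤ r / 2 := min_le_left _ _
    linarith
  have hφA : ∀ s ∈ A, ENNReal.ofReal (Real.exp (-(n * (inner ℝ θ m + d)))) ≤ φ s := by
    intro s hs
    refine ENNReal.ofReal_le_ofReal (Real.exp_le_exp.2 (neg_le_neg ?_))
    have h1 : s = (n : ℝ) • ((n : ℝ)⁻¹ • s) := by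
      rw [smul_smul, mul_inv_cancel₀ (by positivity), one_smul]
    have h2 : inner ℝ θ ((n : ℝ)⁻¹ • s) = inner ℝ θ m + inner ℝ θ ((n : ℝ)⁻¹ • s - m) := by
      rw [inner_sub_right]; ring
    rw [h1, inner_smul_right, h2]
    gcongr
    refine (real_inner_le_norm _ _).trans (le_trans ?_ hθδ)
    gcongr
    exact (mem_ball_iff_norm.1 hs).le
  calc ENNReal.ofReal (Real.exp (-(n * b)))
      ≤ ENNReal.ofReal (Real.exp (n * Real.log Z)) *
          (ENNReal.ofReal (Real.exp (-(n * (inner ℝ θ m + d)))) *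
            ENNReal.ofReal (Real.exp (-d))) := by
        rw [← ENNReal.ofReal_mul (Real.exp_nonneg _), ← ENNReal.ofReal_mul (Real.exp_nonneg _),
          ← Real.exp_add, ← Real.exp_add]
        refine ENNReal.ofReal_le_ofReal (Real.exp_le_exp.2 ?_)
        have h1 : b = a + 2 * d := by simp only [d]; ring
        rw [h1]
        nlinarith [mul_le_mul_of_nonneg_left hcost.le (zero_le_one.trans hn1')]
    _ ≤ ENNReal.ofReal Z ^ n * ∫⁻ s, A.indicator 1 s * φ s ∂(convPow τ n) := by
        have h1 : ENNReal.ofReal Z ^ n = ENNReal.ofReal (Real.exp (n * Real.log Z)) := by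
          rw [← ENNReal.ofReal_pow hZpos.le, Real.exp_nat_mul, Real.exp_log hZpos]
        rw [h1]
        gcongr
        calc _ ≤ ENNReal.ofReal (Real.exp (-(n * (inner ℝ θ m + d)))) * convPow τ n A := by gcongr
          _ = ∫⁻ s in A, ENNReal.ofReal (Real.exp (-(n * (inner ℝ θ m + d)))) ∂(convPow τ n) := by
              rw [setLIntegral_const]
          _ ≤ ∫⁻ s in A, φ s ∂(convPow τ n) := setLIntegral_mono hφ hφA
          _ = _ := by
              rw [← lintegral_indicator hAm]
              refine lintegral_congr fun s => ?_
              by_cases hs : s ∈ A <;> simp [hs]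
    _ ≤ ∫⁻ s, A.indicator 1 s ∂(convPow μ n) := hconv n _ (measurable_one.indicator hAm)
    _ = convPow μ n A := lintegral_indicator_one hAm
    _ ≤ _ := measure_mono hAsub

/-- Cramér's theorem. -/
theorem exponentialBounds_convPow (μ : Measure E) [IsProbabilityMeasure μ]
    (h : ∀ᶠ θ in 𝓝 (0 : E), vecMgf id μ θ < ⊤) :
    ExponentialBounds (fun n A => convPow μ n {s | (n : ℝ)⁻¹ • s ∈ A}) (cramerRate μ) where
  upper C hC a ha := by
    obtain ⟨b, hab, hb⟩ := EReal.lt_iff_exists_real_btwn.1 ha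
    have hab : a < b := by exact_mod_cast hab
    obtain ⟨N, hN⟩ := convPow_isClosed_le h hC fun x hx => hb.trans_le (iInf₂_le x hx)
    -- The number `N` of half-spaces is absorbed by lowering the exponent from `b` to `a`.
    have hlim : Tendsto (fun n : ℕ => Real.exp (n * (b - a))) atTop atTop :=
      Real.tendsto_exp_atTop.comp
        (tendsto_natCast_atTop_atTop.atTop_mul_const (sub_pos.2 hab))
    filter_upwards [hlim.eventually_ge_atTop (N : ℝ), eventually_gt_atTop 0] with n hn hn0
    refine (hN n hn0).trans ?_
    rw [← ENNReal.ofReal_natCast, ← ENNReal.ofReal_mul (by positivity)]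
    refine ENNReal.ofReal_le_ofReal ?_
    calc (N : ℝ) * Real.exp (-(n * b)) ≤ Real.exp (n * (b - a)) * Real.exp (-(n * b)) := by gcongr
      _ = Real.exp (-(n * a)) := by rw [← Real.exp_add]; ring_nf
  lower O hO x hx a ha := by
    obtain ⟨b, hb, hab⟩ := EReal.lt_iff_exists_real_btwn.1 ha
    have hab : b < a := by exact_mod_cast hab
    obtain ⟨r, hr, hball⟩ := Metric.isOpen_iff.1 hO x hx
    filter_upwards [le_convPow_ball hb hab hr] with n hn
    exact hn.trans (measure_mono fun s hs => hball hs)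

end cramer

/-! ### Empirical means and zero-inflated laws -/

section means

variable {E : Type*} [NormedAddCommGroup E] [InnerProductSpace ℝ E] [FiniteDimensional ℝ E]
  [MeasurableSpace E] [BorelSpace E] {Ω : Type*} [MeasurableSpace Ω] {P : Measure Ω}
  [IsProbabilityMeasure P]

theorem measure_mean_mem_eq_convPow {X : ℕ → Ω → E} {μ : Measure E} (hX : ∀ n, Measurable (X n))
    (hind : iIndepFun X P) (hlaw : ∀ n, P.map (X n) = μ) (n : ℕ) {A : Set E}
    (hA : MeasurableSet A) :
    P {ω | (n : ℝ)⁻¹ • ∑ i ∈ Finset.range n, X i ω ∈ A} =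
      convPow μ n {s | (n : ℝ)⁻¹ • s ∈ A} := by
  have hAm : MeasurableSet {s : E | (n : ℝ)⁻¹ • s ∈ A} := measurable_const_smul ((n : ℝ)⁻¹) hA
  rw [← map_sum_eq_convPow hX hind hlaw n, Measure.map_apply (by fun_prop) hAm]
  rfl

omit [FiniteDimensional ℝ E] [IsProbabilityMeasure P] in
theorem vecMgf_id_map {Y : Ω → E} (hY : Measurable Y) [SecondCountableTopology E] :
    vecMgf id (P.map Y) = vecMgf Y P := by
  funext θ
  rw [vecMgf, lintegral_map (by fun_prop) hY]
  rfl

theorem exp_neg_mul_mul_le (n : ℕ) {ε : ℝ} (hε : 0 < ε) (q : ℝ≥0∞) :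
    ENNReal.ofReal (Real.exp (-(n * ε))) * q ≤ q := by
  refine mul_le_of_le_one_left zero_le ?_
  rw [ENNReal.ofReal_le_one, Real.exp_le_one_iff]
  have : 0 ≤ n * ε := by positivity
  linarith

theorem exponentialBounds_mean {X : ℕ → Ω → E} (hX : ∀ n, Measurable (X n)) (hind : iIndepFun X P)
    (hident : ∀ n, IdentDistrib (X n) (X 0) P P)
    (h : ∀ᶠ θ in 𝓝 (0 : E), vecMgf (X 0) P θ < ⊤) :
    IsGoodRateFunction (legendreTransform (vecCgf (X 0) P)) ∧
    ExponentialBounds (fun n A => P {ω | (n : ℝ)⁻¹ • ∑ i ∈ Finset.range n, X i ω ∈ A})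
      (legendreTransform (vecCgf (X 0) P)) := by
  have := Measure.isProbabilityMeasure_map (μ := P) (hX 0).aemeasurable
  have hrate : legendreTransform (vecCgf (X 0) P) = cramerRate (P.map (X 0)) := by
    rw [cramerRate, vecMgf_id_map (hX 0)]
    rfl
  rw [← vecMgf_id_map (hX 0)] at h
  rw [hrate]
  -- The two set functions are identified on measurable sets, which is all that the comparison
  -- needs.
  refine ⟨isGoodRateFunction_cramerRate _ h, (exponentialBounds_convPow _ h).of_comparable ?_ ?_⟩
  all_goals
    refine fun ε hε => Eventually.of_forall fun n A hA => ?_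
    rw [measure_mean_mem_eq_convPow hX hind (fun n => (hident n).map_eq) n hA]
    exact exp_neg_mul_mul_le n hε _

/-- The law that charges `0` with mass `1 - p` and is `ν` otherwise. -/
noncomputable def zeroInflatedLaw (ν : Measure E) (p : ℝ) : Measure E :=
  ENNReal.ofReal (1 - p) • Measure.dirac 0 + ENNReal.ofReal p • ν

omit [InnerProductSpace ℝ E] [FiniteDimensional ℝ E] [BorelSpace E] in
-- The weights of `dirac 0` and of `ν` are compared separately.
theorem smul_zeroInflatedLaw_le (ν : Measure E) {c p q : ℝ} (hc : 0 ≤ c)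
    (h0 : c * (1 - p) ≤ 1 - q) (h1 : c * p ≤ q) :
    ENNReal.ofReal c • zeroInflatedLaw ν p ≤ zeroInflatedLaw ν q := by
  refine Measure.le_iff.2 fun A hA => ?_
  simp only [zeroInflatedLaw, Measure.smul_apply, Measure.add_apply, smul_eq_mul, mul_add,
    ← mul_assoc, ← ENNReal.ofReal_mul hc]
  gcongr

theorem vecMgf_id_zeroInflatedLaw (ν : Measure E) (p : ℝ) (θ : E) :
    vecMgf id (zeroInflatedLaw ν p) θ =
      ENNReal.ofReal (1 - p) + ENNReal.ofReal p * vecMgf id ν θ := by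
  rw [zeroInflatedLaw, vecMgf, lintegral_add_measure, lintegral_smul_measure,
    lintegral_smul_measure, lintegral_dirac' _ (by fun_prop)]
  simp [vecMgf]

theorem IsZeroInflatedFamily.map_eq {ν : Measure E} {X : ℕ → ℝ → Ω → E}
    (h : IsZeroInflatedFamily P ν X) {p : ℝ} (hp : p ∈ Set.Ioc (0 : ℝ) 1) (n : ℕ) :
    P.map (X n p) = zeroInflatedLaw ν p := by
  have hp' : p ∈ Set.Icc (0 : ℝ) 1 := ⟨hp.1.le, hp.2⟩
  have hX := h.measurable p hp' n
  have hS : MeasurableSet {ω | X n p ω ≠ 0} := hX (measurableSet_singleton (0 : E)).compl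
  have hP := h.prob_ne_zero p hp' n
  have hP0 : P {ω | X n p ω ≠ 0} ≠ 0 := by rw [hP]; simpa using hp.1
  ext A hA
  have hAm := hX hA
  have h1 : P (X n p ⁻¹' A ∩ {ω | X n p ω ≠ 0}) = ENNReal.ofReal p * ν A := by
    rw [← h.cond_law p hp n, Measure.map_apply hX hA, cond_apply hS, ← hP, ← mul_assoc,
      ENNReal.mul_inv_cancel hP0 (measure_ne_top _ _), one_mul, Set.inter_comm]
  have h2 : P (X n p ⁻¹' A \ {ω | X n p ω ≠ 0}) =
      ENNReal.ofReal (1 - p) * Measure.dirac (0 : E) A := by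
    have h3 : P {ω | X n p ω ≠ 0}ᶜ = ENNReal.ofReal (1 - p) := by
      rw [prob_compl_eq_one_sub hS, hP, ENNReal.ofReal_sub _ hp.1.le, ENNReal.ofReal_one]
    by_cases h0 : (0 : E) ∈ A
    · rw [Measure.dirac_apply_of_mem h0, mul_one, ← h3]
      congr 1
      ext ω
      simp only [Set.mem_sdiff, Set.mem_preimage, Set.mem_compl_iff]
      refine ⟨fun hω => hω.2, fun hω => ⟨?_, hω⟩⟩
      have : X n p ω = 0 := by simpa using hω
      rwa [this]
    · rw [Measure.dirac_apply' _ hA, Set.indicator_of_notMem h0, mul_zero]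
      convert measure_empty (μ := P)
      ext ω
      simp only [Set.mem_sdiff, Set.mem_preimage, Set.mem_empty_iff_false, iff_false]
      rintro ⟨hω, hω0⟩
      have : X n p ω = 0 := by simpa using hω0
      exact h0 (this ▸ hω)
  rw [Measure.map_apply hX hA, ← measure_inter_add_sdiff _ hS, h1, h2, zeroInflatedLaw,
    Measure.add_apply, Measure.smul_apply, Measure.smul_apply, smul_eq_mul, smul_eq_mul, add_comm]

theorem eventually_exp_neg_mul_le {u : ℕ → ℝ} {l ε : ℝ} (hu : Tendsto u atTop (𝓝 l)) (hl : 0 < l)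
    (hε : 0 < ε) :
    ∀ᶠ n in atTop, Real.exp (-ε) * u n ≤ l ∧ Real.exp (-ε) * l ≤ u n := by
  have hlt : Real.exp (-ε) * l < l := mul_lt_of_lt_one_left hl (by simpa using hε)
  filter_upwards [(hu.const_mul (Real.exp (-ε))).eventually_lt_const hlt,
    hu.eventually_const_lt hlt] with n h1 h2
  exact ⟨h1.le, h2.le⟩

theorem exponentialBounds_zeroInflated {ν : Measure E} {X : ℕ → ℝ → Ω → E}
    (h : IsZeroInflatedFamily P ν X) (hG : ∀ᶠ θ in 𝓝 (0 : E), vecMgf id ν θ < ⊤) {pn : ℕ → ℝ}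
    {p : ℝ} (hp : p ∈ Set.Ioo (0 : ℝ) 1) (hlim : Tendsto pn atTop (𝓝 p)) :
    IsGoodRateFunction (legendreTransform (zeroInflatedCgf p (vecMgf id ν))) ∧
    ExponentialBounds
      (fun n A => P {ω | (n : ℝ)⁻¹ • ∑ i ∈ Finset.range n, X i (pn n) ω ∈ A})
      (legendreTransform (zeroInflatedCgf p (vecMgf id ν))) := by
  have hprob : ∀ q ∈ Set.Ioo (0 : ℝ) 1, IsProbabilityMeasure (zeroInflatedLaw ν q) := fun q hq => by
    rw [← h.map_eq ⟨hq.1, hq.2.le⟩ 0]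
    exact Measure.isProbabilityMeasure_map (h.measurable q ⟨hq.1.le, hq.2.le⟩ 0).aemeasurable
  have := hprob p hp
  have hrate : legendreTransform (zeroInflatedCgf p (vecMgf id ν)) =
      cramerRate (zeroInflatedLaw ν p) := by
    unfold cramerRate zeroInflatedCgf
    simp_rw [vecMgf_id_zeroInflatedLaw]
  have hfin : ∀ᶠ θ in 𝓝 (0 : E), vecMgf id (zeroInflatedLaw ν p) θ < ⊤ := by
    filter_upwards [hG] with θ hθ
    rw [vecMgf_id_zeroInflatedLaw]
    exact ENNReal.add_lt_top.2 ⟨ENNReal.ofReal_lt_top, ENNReal.mul_lt_top ENNReal.ofReal_lt_top hθ⟩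
  rw [hrate]
  have hmean : ∀ n, pn n ∈ Set.Ioo (0 : ℝ) 1 → ∀ A, MeasurableSet A →
      P {ω | (n : ℝ)⁻¹ • ∑ i ∈ Finset.range n, X i (pn n) ω ∈ A} =
        convPow (zeroInflatedLaw ν (pn n)) n {s | (n : ℝ)⁻¹ • s ∈ A} := fun n hn A hA =>
    measure_mean_mem_eq_convPow (h.measurable _ ⟨hn.1.le, hn.2.le⟩)
      (h.indep _ ⟨hn.1.le, hn.2.le⟩) (h.map_eq ⟨hn.1, hn.2.le⟩) n hA
  have hpow : ∀ (n : ℕ) (ε : ℝ),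
      ENNReal.ofReal (Real.exp (-(n * ε))) = ENNReal.ofReal (Real.exp (-ε)) ^ n := fun n ε => by
    rw [← ENNReal.ofReal_pow (Real.exp_nonneg _), ← Real.exp_nat_mul, mul_neg]
  have hset : ∀ (n : ℕ) (A : Set E), MeasurableSet A → MeasurableSet {s : E | (n : ℝ)⁻¹ • s ∈ A} :=
    fun n A hA => (measurable_const_smul ((n : ℝ)⁻¹)) hA
  have hIoo := hlim.eventually (Ioo_mem_nhds hp.1 hp.2)
  refine ⟨isGoodRateFunction_cramerRate _ hfin,
    (exponentialBounds_convPow _ hfin).of_comparable ?_ ?_⟩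
  all_goals
    intro ε hε
    -- Positivity of `p` and of `1 - p` makes both weight ratios tend to `1`.
    filter_upwards [hIoo, eventually_exp_neg_mul_le hlim hp.1 hε,
      eventually_exp_neg_mul_le (hlim.const_sub 1) (sub_pos.2 hp.2) hε] with n hn h1 h0 A hA
    have := hprob _ hn
    rw [hmean n hn A hA, hpow]
  · exact convPow_le_of_le (smul_zeroInflatedLaw_le ν (Real.exp_nonneg _) h0.1 h1.1) n (hset n A hA)
  · exact convPow_le_of_le (smul_zeroInflatedLaw_le ν (Real.exp_nonneg _) h0.2 h1.2) n (hset n A hA)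

end means

theorem mainTheorem11 {Ω : Type*} [MeasurableSpace Ω] (P : Measure Ω) [IsProbabilityMeasure P]
    (h : ℕ) :
    -- zero-inflated sums; the random vectors `X_1, X_2, …` are `X 0, X 1, …`
    (∀ (ν : Measure (EuclideanSpace ℝ (Fin h))) (X : ℕ → ℝ → Ω → EuclideanSpace ℝ (Fin h)),
      IsZeroInflatedFamily P ν X →
      (∀ᶠ θ in 𝓝 (0 : EuclideanSpace ℝ (Fin h)), vecMgf id ν θ < ⊤) →
      ∀ (pn : ℕ → ℝ) (p : ℝ), (∀ n, 1 ≤ n → pn n ∈ Set.Icc (0 : ℝ) 1) → p ∈ Set.Ioo (0 : ℝ) 1 →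
      Tendsto pn atTop (𝓝 p) →
      ((¬ ∃ c, ∀ n, 1 ≤ n → pn n = c) →
        IsEssentiallySmooth (fun θ => ((vecMgf id ν θ : ℝ≥0∞) : EReal))) →
      IsGoodRateFunction (legendreTransform (zeroInflatedCgf p (vecMgf id ν))) ∧
      SatisfiesLDP P (fun n ω => (n : ℝ)⁻¹ • ∑ i ∈ Finset.range n, X i (pn n) ω)
        (fun n => (n : ℝ)) (legendreTransform (zeroInflatedCgf p (vecMgf id ν)))) ∧
    -- continuous images of empirical means; again `X_1, X_2, …` are `X 0, X 1, …`
    (∀ (X : ℕ → Ω → EuclideanSpace ℝ (Fin h)),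
      (∀ n, Measurable (X n)) → iIndepFun X P → (∀ n, IdentDistrib (X n) (X 0) P P) →
      (∀ᶠ θ in 𝓝 (0 : EuclideanSpace ℝ (Fin h)), vecCgf (X 0) P θ < ⊤) →
      ∀ (k : ℕ) (D : Set (EuclideanSpace ℝ (Fin h)))
        (U : EuclideanSpace ℝ (Fin h) → EuclideanSpace ℝ (Fin k)),
      ContinuousOn U D →
      (∀ n : ℕ, 1 ≤ n → ∀ᵐ ω ∂P, (n : ℝ)⁻¹ • ∑ i ∈ Finset.range n, X i ω ∈ D) →
      (∀ x, legendreTransform (vecCgf (X 0) P) x < ⊤ → x ∈ D) →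
      IsGoodRateFunction
        (fun y => ⨅ (x) (_ : x ∈ D ∧ U x = y), legendreTransform (vecCgf (X 0) P) x) ∧
      SatisfiesLDP P (fun n ω => U ((n : ℝ)⁻¹ • ∑ i ∈ Finset.range n, X i ω))
        (fun n => (n : ℝ))
        (fun y => ⨅ (x) (_ : x ∈ D ∧ U x = y), legendreTransform (vecCgf (X 0) P) x)) := by

  refine ⟨fun ν X hX hG pn p _ hp hlim _ => ?_, fun X hX hind hident hfin k D U hU hmem hD => ?_⟩
  · obtain ⟨hgood, hbounds⟩ := exponentialBounds_zeroInflated hX hG hp hlim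
    exact ⟨hgood, hbounds.satisfiesLDP hgood.toIsRateFunction⟩
  · obtain ⟨hgood, hbounds⟩ := exponentialBounds_mean hX hind hident
      (hfin.mono fun θ hθ => ENNReal.log_lt_top_iff.1 hθ)
    have hgoodU := isGoodRateFunction_contractedRate hgood hU hD
    exact ⟨hgoodU, (hbounds.contraction hU hD hmem).satisfiesLDP hgoodU.toIsRateFunction⟩
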